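/- **Proposition (equivalence of the element-based and the nerve-based MCbiF).** Let $X$ be a finite set, let $M\ge 1$, and let $t_1<\dots<t_M$ be real numbers. Let $\theta:[t_1,\infty)\to\Pi_X$ be a sequence of partitions of $X$ with change points $t_1,\dots,t_M$: $\theta(t)=\theta(t_m)$ for $t\in[t_m,t_{m+1})$, $1\le m<M$, and $\theta(t)=\theta(t_M)$ for $t\ge t_M$. Let $P=\{(s,t): t_1\le s\le t\}$, partially ordered by $(s,t)\le(s',t')$ iff $s\ge s'$ and $t\le t'$. Define two filtrations of abstract simplicial complexes indexed by $P$ (simplices are nonempty sets): * the element-based MCbiF $\mathcal M=(K^{s,t})_{(s,t)\in P}$ on the vertex set $X$, where a nonempty $\sigma\subseteq X$ is a simplex of $K^{s,t}$ iff $\sigma\subseteq C$ for some $r\in[s,t]$ and some cluster $C\in\theta(r)$; * the nerve-based MCbiF $\tilde{\mathcal M}=(\tilde K^{s,t})_{(s,t)\in P}$ on the vertex set $\{(m,C): 1\le m\le M,\ C\in\theta(t_m)\}$ (the disjoint union of the sets of clusters), where, with $\ell=\max\{j: t_j\le s\}$ and $m=\max\{j: t_j\le t\}$, a nonempty set $\sigma$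 of vertices is a simplex of $\tilde K^{s,t}$ iff every $(n,C)\in\sigma$ has $\ell\le n\le m$ and $\bigcap_{(n,C)\in\sigma}C\neq\emptyset$. Fix a field $\boldsymbol k$ and total orders on the two vertex sets, and let $H_n$ denote simplicial homology with coefficients in $\boldsymbol k$: the homology of the chain complex with basis the simplices $[x_0,\dots,x_n]$, $x_0<\dots<x_n$, and boundary $\partial[x_0,\dots,x_n]=\sum_{i=0}^n(-1)^i[x_0,\dots,\widehat{x_i},\dots,x_n]$ (and $\partial=0$ on $0$-simplices). Then $\mathcal M$ and $\tilde{\mathcal M}$ have isomorphic persistence modules in every degree: for every $n\ge 0$ the functors $P\to\mathbf{Vect}_{\boldsymbol k}$, $(s,t)\mapsto H_n(K^{s,t})$ and $(s,t)\mapsto H_n(\tilde K^{s,t})$, with the linear maps induced by the inclusions, are naturally isomorphic. -/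

import Mathlib

open CategoryTheory

/-! ### Simplicial homology of an abstract simplicial complex, with field coefficients -/

namespace SimplicialHomology

universe u v

variable {V : Type u} [LinearOrder V]

/-- The `n`-simplices `[x₀, …, xₙ]` of a complex, each written with its vertices in increasing
order `x₀ < … < xₙ`. -/
def Simplex (K : PreAbstractSimplicialComplex V) (n : ℕ) : Type u :=
  {f : Fin (n + 1) ↪o V // Finset.univ.map f.toEmbedding ∈ K}

/-- The face `[x₀, …, x̂ᵢ, …, xₙ₊₁]` of `[x₀, …, xₙ₊₁]`. -/
def Simplex.face {K : PreAbstractSimplicialComplex V} {n : ℕ} (σ : Simplex K (n + 1))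
    (i : Fin (n + 2)) : Simplex K n :=
  ⟨i.succAboveOrderEmb.trans σ.1, by
    refine (K.isRelLowerSet_faces σ.2).2 ?_ (Finset.univ_nonempty.map)
    intro x hx
    simp only [Finset.mem_map, Finset.mem_univ, true_and] at hx ⊢
    obtain ⟨j, rfl⟩ := hx
    exact ⟨i.succAbove j, rfl⟩⟩

theorem Simplex.face_face {K : PreAbstractSimplicialComplex V} {n : ℕ} (σ : Simplex K (n + 2))
    {i j : Fin (n + 2)} (h : i ≤ j) :
    (σ.face j.succ).face i = (σ.face i.castSucc).face j := by
  apply Subtype.ext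
  ext l
  change σ.1 (j.succ.succAbove (i.succAbove l)) = σ.1 (i.castSucc.succAbove (j.succAbove l))
  congr 1
  ext
  simp only [Fin.succAbove, Fin.lt_def, Fin.le_def] at *
  split_ifs <;> simp_all <;> omega

/-- A simplex of a subcomplex, as a simplex of the larger complex. -/
def Simplex.incl {K L : PreAbstractSimplicialComplex V} (h : K ≤ L) {n : ℕ} (σ : Simplex K n) :
    Simplex L n :=
  ⟨σ.1, h σ.2⟩

variable (k : Type v) [Field k]

/-- The vector space of `n`-chains, with basis the `n`-simplices. -/
abbrev Chain (K : PreAbstractSimplicialComplex V) (n : ℕ) : Type (max u v) :=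
  Simplex K n →₀ k

/-- The boundary operator `[x₀, …, xₙ₊₁] ↦ ∑ᵢ (-1)ⁱ [x₀, …, x̂ᵢ, …, xₙ₊₁]`. -/
noncomputable def boundary (K : PreAbstractSimplicialComplex V) (n : ℕ) :
    Chain k K (n + 1) →ₗ[k] Chain k K n :=
  Finsupp.linearCombination k fun σ : Simplex K (n + 1) =>
    ∑ i : Fin (n + 2), (-1 : k) ^ (i : ℕ) • Finsupp.single (σ.face i) (1 : k)

theorem boundary_single (K : PreAbstractSimplicialComplex V) (n : ℕ) (σ : Simplex K (n + 1)) :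
    boundary k K n (Finsupp.single σ 1) =
      ∑ i : Fin (n + 2), (-1 : k) ^ (i : ℕ) • Finsupp.single (σ.face i) (1 : k) := by
  simp [boundary]

theorem boundary_comp_boundary (K : PreAbstractSimplicialComplex V) (n : ℕ) :
    boundary k K n ∘ₗ boundary k K (n + 1) = 0 := by
  refine Finsupp.lhom_ext' fun σ => LinearMap.ext_ring ?_
  simp only [LinearMap.comp_apply, Finsupp.lsingle_apply, boundary_single, map_sum, map_smul,
    Finset.smul_sum, smul_smul, LinearMap.zero_apply]
  rw [← Finset.sum_product', Finset.univ_product_univ]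
  let S : Finset (Fin (n + 3) × Fin (n + 2)) := Finset.univ.filter fun p => (p.1 : ℕ) ≤ p.2
  rw [← Finset.sum_add_sum_compl S, ← eq_neg_iff_add_eq_zero, ← Finset.sum_neg_distrib]
  refine Finset.sum_bij
    (fun p hp => (p.2.succ, p.1.castLT (lt_of_le_of_lt (Finset.mem_filter.mp hp).2 p.2.2)))
    ?_ ?_ ?_ ?_
  · intro p hp
    have := (Finset.mem_filter.mp hp).2
    simp only [S, Finset.mem_compl, Finset.mem_filter, Finset.mem_univ, true_and, Fin.val_succ,
      Fin.val_castLT]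
    omega
  · rintro ⟨i, j⟩ hp ⟨i', j'⟩ hp' h
    simp only [Prod.mk.injEq, Fin.ext_iff, Fin.val_succ, Fin.val_castLT] at h ⊢
    omega
  · rintro ⟨i, j⟩ hp
    simp only [S, Finset.mem_compl, Finset.mem_filter, Finset.mem_univ, true_and, not_le] at hp
    refine ⟨(j.castSucc, i.pred (fun h => by simp [h] at hp)), ?_, ?_⟩
    · simp only [S, Finset.mem_filter, Finset.mem_univ, true_and, Fin.val_castSucc, Fin.val_pred]
      omega
    · ext <;> simp
  · rintro ⟨i, j⟩ hp
    have hij : (i : ℕ) ≤ j := (Finset.mem_filter.mp hp).2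
    have hi : (i : ℕ) < n + 2 := lt_of_le_of_lt hij j.2
    have := σ.face_face (i := i.castLT hi) (j := j) hij
    rw [Fin.castSucc_castLT] at this
    rw [← this, ← neg_smul]
    congr 1
    simp only [Fin.val_succ, Fin.val_castLT, pow_succ]
    ring

/-- The simplicial chain complex `⋯ → C₂ → C₁ → C₀`. -/
noncomputable def chainComplex (K : PreAbstractSimplicialComplex V) :
    ChainComplex (ModuleCat.{max u v} k) ℕ :=
  ChainComplex.of (fun n => ModuleCat.of k (Chain k K n))
    (fun n => ModuleCat.ofHom (boundary k K n))
    (fun n => by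
      rw [← ModuleCat.ofHom_comp, boundary_comp_boundary]
      rfl)

/-- The chain map induced by the inclusion of a subcomplex. -/
noncomputable def chainMap {K L : PreAbstractSimplicialComplex V} (h : K ≤ L) :
    chainComplex k K ⟶ chainComplex k L :=
  ChainComplex.ofHom
    (fun n => ModuleCat.ofHom (Finsupp.lmapDomain k k (Simplex.incl h (n := n))))
    (fun n => by
      simp only [chainComplex, ChainComplex.of_d]
      rw [← ModuleCat.ofHom_comp, ← ModuleCat.ofHom_comp]
      congr 1
      refine Finsupp.lhom_ext' fun σ => LinearMap.ext_ring ?_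
      simp only [LinearMap.comp_apply, Finsupp.lsingle_apply, Finsupp.lmapDomain_apply,
        Finsupp.mapDomain_single, boundary_single, Finsupp.mapDomain_finsetSum,
        Finsupp.mapDomain_smul]
      rfl)

/-- Simplicial complexes on `V` with their inclusions, mapped to chain complexes. -/
noncomputable def chainFunctor :
    PreAbstractSimplicialComplex V ⥤ ChainComplex (ModuleCat.{max u v} k) ℕ where
  obj K := chainComplex k K
  map f := chainMap k (leOfHom f)
  map_id K := HomologicalComplex.hom_ext _ _ fun n =>
    congrArg ModuleCat.ofHom (Finsupp.lmapDomain_id (α := Simplex K n) k k)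
  map_comp f g := HomologicalComplex.hom_ext _ _ fun n =>
    congrArg ModuleCat.ofHom (Finsupp.lmapDomain_comp k k
      (Simplex.incl (leOfHom f) (n := n)) (Simplex.incl (leOfHom g) (n := n)))

/-- The `n`-th simplicial homology, as a functor on simplicial complexes on `V` and inclusions. -/
noncomputable def homology (n : ℕ) :
    PreAbstractSimplicialComplex V ⥤ ModuleCat.{max u v} k :=
  chainFunctor k ⋙ HomologicalComplex.homologyFunctor _ _ n

/-- The `n`-th persistence module of a filtration of simplicial complexes indexed by `P`. -/
noncomputable def persistenceModule {P : Type*} [Preorder P]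
    (F : P →o PreAbstractSimplicialComplex V) (n : ℕ) : P ⥤ ModuleCat.{max u v} k :=
  F.monotone.functor ⋙ homology k n

end SimplicialHomology

/-! ### Sequences of partitions and the two bifiltrations -/

/-- A sequence of partitions of the finite set `X`: a piecewise-constant function `θ` from
`[t₁, ∞)` to the partitions of `X`, with change points `t₁ < ⋯ < t_M` (here indexed from `0`). -/
structure PartitionSequence (X : Type*) [Fintype X] [DecidableEq X] (M : ℕ) [NeZero M] where
  /-- the change points -/
  t : Fin M → ℝ
  strictMono_t : StrictMono t
  /-- the partition at each scale -/
  θ : Set.Ici (t 0) → Finpartition (Finset.univ : Finset X)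
  /-- `θ` is constant on each `[t_m, t_{m+1})`, and on `[t_M, ∞)` for the last change point. -/
  eq_of_mem : ∀ (m : Fin M) (r : Set.Ici (t 0)), t m ≤ r → (∀ m', m < m' → r < t m') →
    θ r = θ ⟨t m, strictMono_t.monotone (Fin.zero_le m)⟩

namespace PartitionSequence

universe u

variable {X : Type u} [Fintype X] [DecidableEq X] {M : ℕ} [NeZero M] (Θ : PartitionSequence X M)

/-- The set `[t₁, ∞)` of scales. -/
abbrev Scale : Type := Set.Ici (Θ.t 0)

/-- The partition `θ(t_m)`. -/
def partitionAt (m : Fin M) : Finpartition (Finset.univ : Finset X) :=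
  Θ.θ ⟨Θ.t m, Θ.strictMono_t.monotone (Fin.zero_le m)⟩

/-- The index poset of the bifiltrations: pairs `(s, t)` with `t₁ ≤ s ≤ t`, ordered by
`(s, t) ≤ (s', t')` iff `s' ≤ s` and `t ≤ t'`. -/
abbrev Index : Type := NonemptyInterval Θ.Scale

/-- The MCbiF: `K^{s,t}` is the union over `r ∈ [s, t]` and over the clusters `C ∈ θ(r)` of the
solid simplices on `C`. -/
def mcbif : Θ.Index →o PreAbstractSimplicialComplex X where
  toFun p :=
    { faces := {σ | σ.Nonempty ∧ ∃ r : Θ.Scale, p.fst ≤ r ∧ r ≤ p.snd ∧ ∃ C ∈ (Θ.θ r).parts, σ ⊆ C}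
      isRelLowerSet_faces := by
        rintro σ ⟨hσ, r, h₁, h₂, C, hC, hσC⟩
        exact ⟨hσ, fun τ hτ hne => ⟨hne, r, h₁, h₂, C, hC, hτ.trans hσC⟩⟩ }
  monotone' := by
    rintro p q ⟨h₁, h₂⟩ σ ⟨hσ, r, hr₁, hr₂, C, hC, hσC⟩
    exact ⟨hσ, r, h₁.trans hr₁, hr₂.trans h₂, C, hC, hσC⟩

/-- The last `m` with `t_m ≤ r`, that is, the `m` with `r ∈ [t_m, t_{m+1})`, or with
`r ∈ [t_M, ∞)` if `m` is the last index. -/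
noncomputable def layer (r : Θ.Scale) : Fin M :=
  (Finset.univ.filter fun m => Θ.t m ≤ r).max'
    ⟨0, Finset.mem_filter.mpr ⟨Finset.mem_univ _, r.2⟩⟩

theorem t_layer_le (r : Θ.Scale) : Θ.t (Θ.layer r) ≤ r :=
  (Finset.mem_filter.mp
    (Finset.max'_mem (Finset.univ.filter fun m => Θ.t m ≤ r)
      ⟨0, Finset.mem_filter.mpr ⟨Finset.mem_univ _, r.2⟩⟩)).2

theorem le_layer {r : Θ.Scale} {m : Fin M} (h : Θ.t m ≤ r) : m ≤ Θ.layer r :=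
  Finset.le_max' _ _ (by simpa using h)

theorem layer_mono : Monotone Θ.layer :=
  fun _ _ h => Θ.le_layer ((Θ.t_layer_le _).trans h)

/-- The disjoint union over `m` of the sets of clusters of `θ(t_m)`: a cluster that occurs in
several partitions has one index for each of them. -/
structure ClusterIndex : Type u where
  /-- the position `m` of the partition -/
  level : Fin M
  /-- the cluster -/
  cluster : Finset X
  mem_parts : cluster ∈ (Θ.partitionAt level).parts

/-- The nerve-based MCbiF: for `s ∈ [t_ℓ, t_{ℓ+1})` and `t ∈ [t_m, t_{m+1})`, the simplices of
`K̃^{s,t}` are the nonempty sets of cluster indices with levels in `{ℓ, …, m}` whose clusters have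
a common element. -/
noncomputable def nerveMcbif : Θ.Index →o PreAbstractSimplicialComplex Θ.ClusterIndex where
  toFun p :=
    { faces := {σ | σ.Nonempty ∧
        (∀ c ∈ σ, Θ.layer p.fst ≤ c.level ∧ c.level ≤ Θ.layer p.snd) ∧
        ∃ x : X, ∀ c ∈ σ, x ∈ c.cluster}
      isRelLowerSet_faces := by
        rintro σ ⟨hσ, hl, x, hx⟩
        exact ⟨hσ, fun τ hτ hne => ⟨hne, fun c hc => hl c (hτ hc), x, fun c hc => hx c (hτ hc)⟩⟩ }
  monotone' := by
    rintro p q ⟨h₁, h₂⟩ σ ⟨hσ, hl, x, hx⟩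
    exact ⟨hσ, fun c hc => ⟨(Θ.layer_mono h₁).trans (hl c hc).1,
      (hl c hc).2.trans (Θ.layer_mono h₂)⟩, x, hx⟩

end PartitionSequence

/-!
The proof is Dowker's theorem in functorial form. Let `R` be the relation between the points of `X`
and the clusters with level between that of `s` and that of `t`, given by membership. A set of
points is a simplex of `K^{s,t}` if and only if it is nonempty and its elements are all related to
one cluster, since the clusters of `θ(r)`, `s ≤ r ≤ t`, are those with level in this range
(`PartitionSequence.mem_mcbif_iff`). A set of clusters is a simplex of `K̃^{s,t}` if and only if it
is nonempty and its elements are all related to one point. So the two complexes are the two Dowker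
complexes of `R`.

Both are full subcomplexes of one complex on the disjoint union of the two vertex sets
(`joinComplex`), whose simplices are the sets `σ ⊔ τ` with all elements of `σ` related to all of
`τ` (and, if one of them is empty, with the other a simplex of its Dowker complex). The inclusions
are natural in `(s, t)`, so it suffices that each is an isomorphism in homology, that is, that the
quotient complexes are acyclic. Take first the subcomplex on the points, so that the simplices with
`τ ≠ ∅` span the quotient. For each `τ` pick a point `x(τ)` related to all of `τ`. Let `h` send
`σ ⊔ τ` to `± (σ ∪ {x(τ)}) ⊔ τ`, or to zero if `x(τ) ∈ σ`. Faces that delete an element of `τ` have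
a smaller `τ`; up to those, `∂h + h∂` is the identity (`single_sub_homotopy_mem_supported`). A
relative cycle `c` can thus be replaced by `c - ∂hc`, which has smaller sets `τ`, and repeating this
moves `c` into the subcomplex (`exists_sub_setBoundary_mem_supported`). For the subcomplex on the
clusters, exchange the roles of `σ` and `τ`.

The signs are handled in a model where a simplex is just its set of vertices and the coefficient of
the face `S \ {x}` in the boundary of `S` depends on the number of elements of `S` below `x`. There
the inserted vertex may take any position.
-/

namespace SimplicialHomology

universe u v

/-! ### Chains on finite sets of vertices -/

section SignedSets

variable {V : Type u} [LinearOrder V] (k : Type v) [Field k]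

/-- The sign with which the face `S \ {x}` occurs in the boundary of `S`, namely `(-1)ⁱ` if `x` is
the `i`-th element of `S`, counted from `0`. It is defined also for `x ∉ S`, where it is the sign
of `x` in `S ∪ {x}`. -/
def faceSign (S : Finset V) (x : V) : k :=
  (-1) ^ (S.filter (· < x)).card

theorem faceSign_mul_self (S : Finset V) (x : V) : faceSign k S x * faceSign k S x = 1 := by
  rw [faceSign, ← mul_pow]
  simp

theorem faceSign_insert_self (S : Finset V) (x : V) :
    faceSign k (insert x S) x = faceSign k S x := by
  simp [faceSign, Finset.filter_insert]

theorem faceSign_erase_self (S : Finset V) (x : V) :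
    faceSign k (S.erase x) x = faceSign k S x := by
  simp [faceSign, Finset.filter_erase]

/-- In passing from `S` to `S ∪ {w} \ {x}`, inserting `w` first and deleting `x` first give opposite
signs. -/
theorem faceSign_insert_add_faceSign_erase {S : Finset V} {w x : V} (hw : w ∉ S) (hx : x ∈ S) :
    faceSign k S w * faceSign k (insert w S) x + faceSign k S x * faceSign k (S.erase x) w = 0 := by
  have hne : x ≠ w := fun h => hw (h ▸ hx)
  rcases lt_or_gt_of_ne hne with h | h
  · have h₁ : faceSign k (insert w S) x = faceSign k S x := by
      simp [faceSign, Finset.filter_insert, h.not_gt]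
    have h₂ : faceSign k S w = -faceSign k (S.erase x) w := by
      have hmem : x ∈ S.filter (· < w) := by simp [hx, h]
      rw [faceSign, faceSign, Finset.filter_erase, ← Finset.card_erase_add_one hmem, pow_succ]
      ring
    rw [h₁, h₂]
    ring
  · have h₁ : faceSign k (insert w S) x = -faceSign k S x := by
      have hmem : w ∉ S.filter (· < x) := by simp [hw]
      rw [faceSign, faceSign, Finset.filter_insert, if_pos h, Finset.card_insert_of_notMem hmem,
        pow_succ]
      ring
    have h₂ : faceSign k (S.erase x) w = faceSign k S w := by
      have hmem : x ∉ S.filter (· < w) := by simp [h.not_gt]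
      rw [faceSign, faceSign, Finset.filter_erase, Finset.erase_eq_of_notMem hmem]
    rw [h₁, h₂]
    ring

theorem faceSign_erase_swap {S : Finset V} {x y : V} (hx : x ∈ S) (hy : y ∈ S) (hxy : x ≠ y) :
    faceSign k S x * faceSign k (S.erase x) y + faceSign k S y * faceSign k (S.erase y) x = 0 := by
  have h := faceSign_insert_add_faceSign_erase k (S := S.erase y) (w := y) (x := x)
    (Finset.notMem_erase y S) (Finset.mem_erase.mpr ⟨hxy, hx⟩)
  rw [Finset.insert_erase hy, faceSign_erase_self, Finset.erase_right_comm,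
    faceSign_erase_self] at h
  -- multiply by the product of the two signs that have to change sides
  linear_combination (faceSign k S y * faceSign k (S.erase x) y) * h
    - (faceSign k S x * faceSign k (S.erase x) y) * faceSign_mul_self k S y
    - (faceSign k S y * faceSign k (S.erase y) x) * faceSign_mul_self k (S.erase x) y

/-- The augmented boundary operator on formal combinations of finite sets,
`S ↦ ∑_{x ∈ S} ± S \ {x}`. All degrees are treated at once, and the boundary of a vertex is the
empty set. -/
noncomputable def setBoundary : (Finset V →₀ k) →ₗ[k] (Finset V →₀ k) :=
  Finsupp.linearCombination k fun S : Finset V =>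
    ∑ x ∈ S, faceSign k S x • Finsupp.single (S.erase x) (1 : k)

theorem setBoundary_single (S : Finset V) :
    setBoundary k (Finsupp.single S 1) =
      ∑ x ∈ S, faceSign k S x • Finsupp.single (S.erase x) (1 : k) := by
  simp [setBoundary]

theorem setBoundary_setBoundary (c : Finset V →₀ k) : setBoundary k (setBoundary k c) = 0 := by
  suffices h : setBoundary k ∘ₗ setBoundary k = (0 : (Finset V →₀ k) →ₗ[k] (Finset V →₀ k)) from
    LinearMap.congr_fun h c
  refine Finsupp.lhom_ext' fun S => LinearMap.ext_ring ?_
  simp only [LinearMap.comp_apply, Finsupp.lsingle_apply, setBoundary_single, map_sum, map_smul,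
    Finset.smul_sum, smul_smul, LinearMap.zero_apply]
  rw [Finset.sum_sigma']
  refine Finset.sum_involution (fun (p : Σ _ : V, V) _ => (⟨p.2, p.1⟩ : Σ _ : V, V)) ?_ ?_ ?_ ?_
  · rintro ⟨x, y⟩ h
    simp only [Finset.mem_sigma, Finset.mem_erase] at h
    rw [Finset.erase_right_comm (a := y), ← add_smul,
      faceSign_erase_swap k h.1 h.2.2 (Ne.symm h.2.1), zero_smul]
  · rintro ⟨x, y⟩ h _ heq
    simp only [Finset.mem_sigma, Finset.mem_erase] at h
    simp only [Sigma.mk.injEq, heq_eq_eq] at heq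
    exact h.2.1 heq.1
  · rintro ⟨x, y⟩ h
    simp only [Finset.mem_sigma, Finset.mem_erase] at h ⊢
    exact ⟨h.2.2, Ne.symm h.2.1, h.1⟩
  · rintro ⟨x, y⟩ _
    rfl

theorem setBoundary_mem_supported (J : PreAbstractSimplicialComplex V) {n : ℕ}
    {c : Finset V →₀ k} (hc : c ∈ Finsupp.supported k k {S | S ∈ J ∧ S.card = n + 2}) :
    setBoundary k c ∈ Finsupp.supported k k {S | S ∈ J ∧ S.card = n + 1} := by
  rw [Finsupp.supported_eq_span_single] at hc
  refine Submodule.span_le (p := (Finsupp.supported k k _).comap (setBoundary k)).mpr ?_ hc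
  rintro _ ⟨S, ⟨hS, hcard⟩, rfl⟩
  rw [SetLike.mem_coe, Submodule.mem_comap, setBoundary_single]
  refine Submodule.sum_mem _ fun x hx =>
    Submodule.smul_mem _ _ (Finsupp.single_mem_supported k _ ?_)
  have hcard' : (S.erase x).card = n + 1 := by rw [Finset.card_erase_of_mem hx, hcard]; rfl
  exact ⟨(J.isRelLowerSet_faces hS).2 (Finset.erase_subset _ _)
    (Finset.card_pos.mp (by omega)), hcard'⟩

/-! ### Collapsing onto a subcomplex -/

variable (U : V → Prop) [DecidablePred U] (v : Finset V → V)

/-- The operator `S ↦ ± S ∪ {v(T)}`, where `T` is the set of vertices of `S` that satisfy `U`; it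
is zero on `S` if `T` is empty or `v(T)` already lies in `S`. -/
noncomputable def insertion : (Finset V →₀ k) →ₗ[k] (Finset V →₀ k) :=
  Finsupp.linearCombination k fun S : Finset V =>
    if (S.filter U).Nonempty ∧ v (S.filter U) ∉ S then
      faceSign k S (v (S.filter U)) • Finsupp.single (insert (v (S.filter U)) S) (1 : k)
    else 0

theorem insertion_single (S : Finset V) :
    insertion k U v (Finsupp.single S 1) =
      if (S.filter U).Nonempty ∧ v (S.filter U) ∉ S then
        faceSign k S (v (S.filter U)) • Finsupp.single (insert (v (S.filter U)) S) (1 : k)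
      else 0 := by
  simp [insertion]

variable {U v}

theorem insertion_of_filter_eq_empty {c : Finset V →₀ k}
    (hc : c ∈ Finsupp.supported k k {S : Finset V | S.filter U = ∅}) :
    insertion k U v c = 0 := by
  rw [Finsupp.supported_eq_span_single] at hc
  refine Submodule.span_le (p := LinearMap.ker (insertion k U v)).mpr ?_ hc
  rintro _ ⟨S, hS, rfl⟩
  have hS' : S.filter U = ∅ := hS
  simp [insertion_single, hS']

variable {J : PreAbstractSimplicialComplex V}

theorem insertion_mem_supported
    (hv : ∀ S ∈ J, (S.filter U).Nonempty → ¬ U (v (S.filter U)) ∧ insert (v (S.filter U)) S ∈ J)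
    {S : Finset V} (hS : S ∈ J) :
    insertion k U v (Finsupp.single S 1) ∈ Finsupp.supported k k
      {T | T ∈ J ∧ T.filter U = S.filter U ∧ T.card = S.card + 1} := by
  rw [insertion_single]
  split_ifs with h
  · obtain ⟨hU, hJ⟩ := hv S hS h.1
    refine Submodule.smul_mem _ _ (Finsupp.single_mem_supported k _ ⟨hJ, ?_, ?_⟩)
    · rw [Finset.filter_insert, if_neg hU]
    · exact Finset.card_insert_of_notMem h.2
  · exact Submodule.zero_mem _

/-- Modulo chains with fewer vertices in `U`, the operator `insertion` is a contracting homotopy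
of the chains with a vertex in `U`. -/
theorem single_sub_homotopy_mem_supported
    (hv : ∀ S ∈ J, (S.filter U).Nonempty → ¬ U (v (S.filter U)) ∧ insert (v (S.filter U)) S ∈ J)
    {S : Finset V} (hS : S ∈ J) {j : ℕ} (hj : (S.filter U).card = j + 1) :
    Finsupp.single S 1 - setBoundary k (insertion k U v (Finsupp.single S 1))
      - insertion k U v (setBoundary k (Finsupp.single S 1)) ∈
        Finsupp.supported k k {T : Finset V | (T.filter U).card ≤ j} := by
  have hne : (S.filter U).Nonempty := Finset.card_pos.mp (by omega)
  have hvU := (hv S hS hne).1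
  -- deleting a vertex in `U` lowers the filtration degree
  have hlow : ∀ x ∈ S, U x → ((S.erase x).filter U).card = j := by
    intro x hx hxU
    rw [Finset.filter_erase, Finset.card_erase_of_mem (by simp [hx, hxU]), hj]
    rfl
  -- deleting a vertex outside `U` does not change the vertex to be inserted
  have hkeep : ∀ x, ¬ U x → (S.erase x).filter U = S.filter U := by
    intro x hxU
    rw [Finset.filter_erase, Finset.erase_eq_of_notMem (by simp [hxU])]
  have hins : ∀ x ∈ S, U x → insertion k U v (Finsupp.single (S.erase x) 1) ∈
      Finsupp.supported k k {T : Finset V | (T.filter U).card ≤ j} := by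
    intro x hx hxU
    rcases (S.erase x).eq_empty_or_nonempty with h | h
    · simp [h, insertion_single]
    · have hJ : S.erase x ∈ J := (J.isRelLowerSet_faces hS).2 (Finset.erase_subset _ _) h
      refine Finsupp.supported_mono ?_ (insertion_mem_supported k hv hJ)
      rintro T ⟨-, hT, -⟩
      exact (congrArg Finset.card hT).le.trans (hlow x hx hxU).le
  by_cases hvS : v (S.filter U) ∈ S
  · have h₀ : insertion k U v (Finsupp.single S 1) = 0 := by
      rw [insertion_single, if_neg (fun h => h.2 hvS)]
    have h₁ : faceSign k S (v (S.filter U)) •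
        insertion k U v (Finsupp.single (S.erase (v (S.filter U))) 1) = Finsupp.single S 1 := by
      rw [insertion_single, hkeep _ hvU, if_pos ⟨hne, Finset.notMem_erase _ _⟩,
        faceSign_erase_self, smul_smul, faceSign_mul_self, one_smul, Finset.insert_erase hvS]
    rw [h₀, map_zero, sub_zero, setBoundary_single, map_sum, ← Finset.add_sum_erase S _ hvS,
      map_smul, h₁, sub_add_cancel_left]
    refine Submodule.neg_mem _ (Submodule.sum_mem _ fun x hx => ?_)
    obtain ⟨hxv, hxS⟩ := Finset.mem_erase.mp hx
    rw [map_smul]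
    refine Submodule.smul_mem _ _ ?_
    by_cases hxU : U x
    · exact hins x hxS hxU
    · rw [insertion_single, hkeep x hxU,
        if_neg (fun h => h.2 (Finset.mem_erase.mpr ⟨Ne.symm hxv, hvS⟩))]
      exact Submodule.zero_mem _
  · rw [insertion_single, if_pos ⟨hne, hvS⟩, map_smul, setBoundary_single, setBoundary_single,
      Finset.sum_insert hvS, faceSign_insert_self, Finset.erase_insert hvS, smul_add, smul_smul,
      faceSign_mul_self, one_smul, sub_add_cancel_left, map_sum, Finset.smul_sum,
      ← Finset.sum_neg_distrib, ← Finset.sum_sub_distrib]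
    refine Submodule.sum_mem _ fun x hx => ?_
    have hxv : v (S.filter U) ≠ x := fun h => hvS (h ▸ hx)
    rw [map_smul, smul_smul]
    by_cases hxU : U x
    · refine Submodule.sub_mem _ (Submodule.neg_mem _ (Submodule.smul_mem _ _
        (Finsupp.single_mem_supported k _ ?_))) (Submodule.smul_mem _ _ (hins x hx hxU))
      change (((insert (v (S.filter U)) S).erase x).filter U).card ≤ j
      rw [Finset.erase_insert_of_ne hxv, Finset.filter_insert, if_neg hvU, hlow x hx hxU]
    · rw [insertion_single, hkeep x hxU,
        if_pos ⟨hne, fun h => hvS (Finset.mem_of_mem_erase h)⟩, smul_smul,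
        Finset.erase_insert_of_ne hxv, ← neg_smul, ← sub_smul, sub_eq_add_neg, ← neg_add,
        faceSign_insert_add_faceSign_erase k hvS hx, neg_zero, zero_smul]
      exact Submodule.zero_mem _

/-- The complex `J` is acyclic relative to its part with no vertex in `U`, if every simplex of `J`
with a vertex in `U` can be enlarged by a vertex outside `U` that depends only on its set of
vertices in `U`. -/
theorem exists_sub_setBoundary_mem_supported
    (hv : ∀ S ∈ J, (S.filter U).Nonempty → ¬ U (v (S.filter U)) ∧ insert (v (S.filter U)) S ∈ J)
    {n : ℕ} {c : Finset V →₀ k}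
    (hc : c ∈ Finsupp.supported k k {S | S ∈ J ∧ S.card = n + 1})
    (hd : setBoundary k c ∈ Finsupp.supported k k {S : Finset V | S.filter U = ∅}) :
    ∃ d ∈ Finsupp.supported k k {S | S ∈ J ∧ S.card = n + 2},
      c - setBoundary k d ∈ Finsupp.supported k k {S : Finset V | S.filter U = ∅} := by
  -- induct on the largest number of vertices in `U` of a simplex that occurs in `c`
  obtain ⟨j, hj⟩ : ∃ j, c ∈ Finsupp.supported k k {S : Finset V | (S.filter U).card ≤ j} :=
    ⟨c.support.sup fun S => (S.filter U).card, fun S hS =>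
      Finset.le_sup (f := fun S : Finset V => (S.filter U).card) hS⟩
  induction j generalizing c with
  | zero =>
    refine ⟨0, Submodule.zero_mem _, ?_⟩
    simpa using hj
  | succ j ih =>
    have hmem : insertion k U v c ∈ Finsupp.supported k k {S | S ∈ J ∧ S.card = n + 2} := by
      rw [Finsupp.supported_eq_span_single] at hc
      refine Submodule.span_le
        (p := (Finsupp.supported k k _).comap (insertion k U v)).mpr ?_ hc
      rintro _ ⟨S, ⟨hS, hcard⟩, rfl⟩
      refine Finsupp.supported_mono ?_ (insertion_mem_supported k hv hS)
      rintro T ⟨hT, -, hTcard⟩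
      exact ⟨hT, by rw [hTcard, hcard]⟩
    have hlow : c - setBoundary k (insertion k U v c) ∈
        Finsupp.supported k k {S : Finset V | (S.filter U).card ≤ j} := by
      have hall : c ∈ Finsupp.supported k k {S | S ∈ J ∧ (S.filter U).card ≤ j + 1} :=
        fun S hS => ⟨(hc hS).1, hj hS⟩
      have hop : ∀ e ∈ Finsupp.supported k k {S | S ∈ J ∧ (S.filter U).card ≤ j + 1},
          e - setBoundary k (insertion k U v e) - insertion k U v (setBoundary k e) ∈
            Finsupp.supported k k {S : Finset V | (S.filter U).card ≤ j} := by
        intro e he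
        rw [Finsupp.supported_eq_span_single] at he
        refine Submodule.span_le (p := (Finsupp.supported k k _).comap (LinearMap.id
          - setBoundary k ∘ₗ insertion k U v - insertion k U v ∘ₗ setBoundary k)).mpr ?_ he
        rintro _ ⟨S, ⟨hS, hcard⟩, rfl⟩
        have hcard' : (S.filter U).card ≤ j + 1 := hcard
        rcases Nat.eq_zero_or_pos (S.filter U).card with h | h
        · have hS₀ : S.filter U = ∅ := Finset.card_eq_zero.mp h
          have h₁ : insertion k U v (Finsupp.single S 1) = 0 :=
            insertion_of_filter_eq_empty k (Finsupp.single_mem_supported k _ hS₀)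
          have h₂ : insertion k U v (setBoundary k (Finsupp.single S 1)) = 0 := by
            refine insertion_of_filter_eq_empty k ?_
            rw [setBoundary_single]
            refine Submodule.sum_mem _ fun x _ =>
              Submodule.smul_mem _ _ (Finsupp.single_mem_supported k _ ?_)
            change (S.erase x).filter U = ∅
            rw [Finset.filter_erase, hS₀, Finset.erase_empty]
          simp only [SetLike.mem_coe, Submodule.mem_comap, LinearMap.sub_apply, LinearMap.id_apply,
            LinearMap.comp_apply, h₁, h₂, map_zero, sub_zero]
          exact Finsupp.single_mem_supported k _ (h.le.trans (Nat.zero_le j))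
        · obtain ⟨i, hi⟩ : ∃ i, (S.filter U).card = i + 1 := ⟨_, (Nat.sub_add_cancel h).symm⟩
          refine Finsupp.supported_mono ?_ (single_sub_homotopy_mem_supported k hv hS hi)
          exact fun T hT => le_trans (b := i) hT (by omega)
      have := hop c hall
      rwa [insertion_of_filter_eq_empty k hd, sub_zero] at this
    obtain ⟨d, hdJ, hd'⟩ := ih (c := c - setBoundary k (insertion k U v c))
      (Submodule.sub_mem _ hc (setBoundary_mem_supported k J hmem))
      (by rwa [map_sub, setBoundary_setBoundary, sub_zero]) hlow
    refine ⟨insertion k U v c + d, Submodule.add_mem _ hmem hdJ, ?_⟩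
    rwa [map_add, ← sub_sub]

end SignedSets
/-! ### Simplicial chains as chains on finite sets -/

section Vertices

variable {V : Type u} [LinearOrder V]

/-- The set of vertices of a simplex. -/
def Simplex.vertices {K : PreAbstractSimplicialComplex V} {n : ℕ} (σ : Simplex K n) : Finset V :=
  Finset.univ.map σ.1.toEmbedding

theorem Simplex.vertices_mem {K : PreAbstractSimplicialComplex V} {n : ℕ} (σ : Simplex K n) :
    σ.vertices ∈ K :=
  σ.2

theorem Simplex.card_vertices {K : PreAbstractSimplicialComplex V} {n : ℕ} (σ : Simplex K n) :
    σ.vertices.card = n + 1 := by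
  simp [Simplex.vertices]

theorem Simplex.vertices_injective {K : PreAbstractSimplicialComplex V} {n : ℕ} :
    Function.Injective (Simplex.vertices : Simplex K n → Finset V) := by
  intro σ τ h
  have h' := congrArg (fun S : Finset V => (S : Set V)) h
  simp only [Simplex.vertices, Finset.coe_map, Finset.coe_univ, Set.image_univ] at h'
  exact Subtype.ext (OrderEmbedding.range_inj.mp h')

theorem Simplex.exists_vertices_eq {K : PreAbstractSimplicialComplex V} {n : ℕ} {S : Finset V}
    (hS : S ∈ K) (hcard : S.card = n + 1) : ∃ σ : Simplex K n, σ.vertices = S := by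
  have h : Finset.univ.map (S.orderEmbOfFin hcard).toEmbedding = S :=
    Finset.map_orderEmbOfFin_univ S hcard
  exact ⟨⟨S.orderEmbOfFin hcard, by rwa [h]⟩, h⟩

theorem Simplex.vertices_face {K : PreAbstractSimplicialComplex V} {n : ℕ} (σ : Simplex K (n + 1))
    (i : Fin (n + 2)) : (σ.face i).vertices = σ.vertices.erase (σ.1 i) := by
  ext x
  simp only [Simplex.vertices, Simplex.face, Finset.mem_map, Finset.mem_univ, true_and,
    Finset.mem_erase]
  constructor
  · rintro ⟨j, rfl⟩
    exact ⟨fun h => Fin.succAbove_ne i j (σ.1.injective h), i.succAbove j, rfl⟩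
  · rintro ⟨hx, j, rfl⟩
    obtain ⟨l, rfl⟩ := Fin.exists_succAbove_eq (x := j) (y := i) (fun h => hx (h ▸ rfl))
    exact ⟨l, rfl⟩

variable (k : Type v) [Field k]

theorem Simplex.faceSign_vertices {K : PreAbstractSimplicialComplex V} {n : ℕ} (σ : Simplex K n)
    (i : Fin (n + 1)) : faceSign k σ.vertices (σ.1 i) = (-1) ^ (i : ℕ) := by
  have h : σ.vertices.filter (· < σ.1 i) = (Finset.Iio i).map σ.1.toEmbedding := by
    ext x
    simp only [Simplex.vertices, Finset.mem_filter, Finset.mem_map, Finset.mem_univ, true_and,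
      Finset.mem_Iio]
    constructor
    · rintro ⟨⟨j, rfl⟩, hj⟩
      exact ⟨j, σ.1.lt_iff_lt.mp hj, rfl⟩
    · rintro ⟨j, hj, rfl⟩
      exact ⟨⟨j, rfl⟩, σ.1.lt_iff_lt.mpr hj⟩
  rw [faceSign, h, Finset.card_map, Fin.card_Iio]

/-- A simplicial chain, as a formal combination of sets of vertices. -/
noncomputable def toSets (K : PreAbstractSimplicialComplex V) (n : ℕ) :
    Chain k K n →ₗ[k] (Finset V →₀ k) :=
  Finsupp.lmapDomain k k Simplex.vertices

theorem toSets_single {K : PreAbstractSimplicialComplex V} {n : ℕ} (σ : Simplex K n) (a : k) :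
    toSets k K n (Finsupp.single σ a) = Finsupp.single σ.vertices a :=
  Finsupp.mapDomain_single

theorem toSets_injective (K : PreAbstractSimplicialComplex V) (n : ℕ) :
    Function.Injective (toSets k K n) :=
  Finsupp.mapDomain_injective Simplex.vertices_injective

theorem toSets_boundary (K : PreAbstractSimplicialComplex V) (n : ℕ) (c : Chain k K (n + 1)) :
    toSets k K n (boundary k K n c) = setBoundary k (toSets k K (n + 1) c) := by
  suffices h : toSets k K n ∘ₗ boundary k K n = setBoundary k ∘ₗ toSets k K (n + 1) from
    LinearMap.congr_fun h c
  refine Finsupp.lhom_ext' fun σ => LinearMap.ext_ring ?_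
  simp only [LinearMap.comp_apply, Finsupp.lsingle_apply, boundary_single, map_sum, map_smul,
    toSets_single, setBoundary_single]
  rw [show (∑ x ∈ σ.vertices, faceSign k σ.vertices x • Finsupp.single (σ.vertices.erase x) (1 : k))
    = _ from Finset.sum_map _ _ _]
  refine Finset.sum_congr rfl fun i _ => ?_
  change _ = faceSign k σ.vertices (σ.1 i) • Finsupp.single (σ.vertices.erase (σ.1 i)) (1 : k)
  rw [Simplex.faceSign_vertices, Simplex.vertices_face]

theorem range_toSets (K : PreAbstractSimplicialComplex V) (n : ℕ) :
    LinearMap.range (toSets k K n) = Finsupp.supported k k {S | S ∈ K ∧ S.card = n + 1} := by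
  apply le_antisymm
  · rintro _ ⟨c, rfl⟩
    refine Finsupp.induction_linear c ?_ ?_ ?_
    · rw [map_zero]
      exact Submodule.zero_mem _
    · intro c d hc hd
      rw [map_add]
      exact Submodule.add_mem _ hc hd
    · intro σ a
      rw [toSets_single]
      exact Finsupp.single_mem_supported k _ ⟨σ.vertices_mem, σ.card_vertices⟩
  · rw [Finsupp.supported_eq_span_single, Submodule.span_le]
    rintro _ ⟨S, ⟨hS, hcard⟩, rfl⟩
    obtain ⟨σ, rfl⟩ := Simplex.exists_vertices_eq hS hcard
    exact ⟨Finsupp.single σ 1, toSets_single k σ 1⟩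

end Vertices

/-! ### Embeddings of complexes along order embeddings of the vertex sets -/

section Embedding

variable {V W : Type u} [LinearOrder V] [LinearOrder W] (k : Type v) [Field k] (f : V ↪o W)
  {K : PreAbstractSimplicialComplex V} {L : PreAbstractSimplicialComplex W}
  (h : ∀ S ∈ K, S.map f.toEmbedding ∈ L)

/-- The image of a simplex under an order embedding of the vertex sets. -/
def Simplex.map {n : ℕ} (σ : Simplex K n) : Simplex L n :=
  ⟨σ.1.trans f, by
    have := h _ σ.2
    rwa [Finset.map_map] at this⟩

/-- The chain map induced by an order embedding of the vertex sets. -/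
noncomputable def chainMapOfEmbedding : chainComplex k K ⟶ chainComplex k L :=
  ChainComplex.ofHom
    (fun n => ModuleCat.ofHom (Finsupp.lmapDomain k k (Simplex.map f h (n := n))))
    (fun n => by
      simp only [chainComplex, ChainComplex.of_d]
      rw [← ModuleCat.ofHom_comp, ← ModuleCat.ofHom_comp]
      congr 1
      refine Finsupp.lhom_ext' fun σ => LinearMap.ext_ring ?_
      simp only [LinearMap.comp_apply, Finsupp.lsingle_apply, Finsupp.lmapDomain_apply,
        Finsupp.mapDomain_single, boundary_single, Finsupp.mapDomain_finsetSum,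
        Finsupp.mapDomain_smul]
      rfl)

theorem chainMapOfEmbedding_injective (n : ℕ) :
    Function.Injective ((chainMapOfEmbedding k f h).f n) := by
  refine Finsupp.mapDomain_injective fun σ τ hστ => Subtype.ext ?_
  ext i
  exact f.injective (DFunLike.congr_fun (congrArg Subtype.val hστ) i)

/-- A chain comes from the smaller complex if and only if all its simplices have their vertices in
the image of the embedding. -/
theorem mem_range_chainMapOfEmbedding_iff (h' : ∀ S, S.map f.toEmbedding ∈ L → S ∈ K)
    (n : ℕ) (c : Chain k L n) :
    c ∈ LinearMap.range (Finsupp.lmapDomain k k (Simplex.map f h (n := n))) ↔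
      toSets k L n c ∈ Finsupp.supported k k {S : Finset W | ∀ w ∈ S, w ∈ Set.range f} := by
  constructor
  · rintro ⟨c, rfl⟩
    refine Finsupp.induction_linear c ?_ ?_ ?_
    · simp only [map_zero]
      exact Submodule.zero_mem _
    · intro c d hc hd
      rw [map_add, map_add]
      exact Submodule.add_mem _ hc hd
    · intro σ a
      rw [Finsupp.lmapDomain_apply, Finsupp.mapDomain_single, toSets_single]
      refine Finsupp.single_mem_supported k _ fun w hw => ?_
      obtain ⟨i, -, rfl⟩ := Finset.mem_map.mp hw
      exact ⟨σ.1 i, rfl⟩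
  · intro hc
    have hc' : c ∈ Finsupp.supported k k (Set.range (Simplex.map f h (n := n))) := by
      intro σ hσ
      have hmem : σ.vertices ∈ (toSets k L n c).support := by
        rw [Finset.mem_coe, Finsupp.mem_support_iff] at hσ
        rwa [Finsupp.mem_support_iff, toSets, Finsupp.lmapDomain_apply,
          Finsupp.mapDomain_apply Simplex.vertices_injective]
      have hran := hc hmem
      choose g hg using fun i => hran _ (Finset.mem_map_of_mem σ.1.toEmbedding (Finset.mem_univ i))
      have hg' : ∀ i, f (g i) = σ.1 i := hg
      have hmono : StrictMono g := fun i j hij => by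
        rw [← f.lt_iff_lt, hg', hg']
        exact σ.1.strictMono hij
      have heq : (OrderEmbedding.ofStrictMono g hmono).trans f = σ.1 := by
        ext i
        exact hg' i
      refine ⟨⟨OrderEmbedding.ofStrictMono g hmono, h' _ ?_⟩, Subtype.ext heq⟩
      rw [Finset.map_map]
      change Finset.univ.map ((OrderEmbedding.ofStrictMono g hmono).trans f).toEmbedding ∈ L
      rw [heq]
      exact σ.2
    rw [Finsupp.supported_eq_span_single] at hc'
    refine Submodule.span_le.mpr ?_ hc'
    rintro _ ⟨_, ⟨σ, rfl⟩, rfl⟩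
    exact ⟨Finsupp.single σ 1, Finsupp.mapDomain_single⟩

end Embedding
/-! ### A criterion for isomorphisms in homology -/

section Criterion

/-- A degreewise injective chain map induces isomorphisms in homology if every chain whose boundary
lies in the image is a boundary modulo the image; that is, if the quotient complex is
acyclic. -/
theorem isIso_homologyMap_of_relative_acyclic {R : Type*} [Ring R]
    {C D : ChainComplex (ModuleCat R) ℕ} (φ : C ⟶ D)
    (hinj : ∀ n, Function.Injective (φ.f n))
    (hrel : ∀ n (c : D.X n), (∀ m, D.d n m c ∈ LinearMap.range (φ.f m).hom) →
      ∃ d : D.X (n + 1), c - D.d (n + 1) n d ∈ LinearMap.range (φ.f n).hom) (n : ℕ) :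
    IsIso (HomologicalComplex.homologyMap φ n) := by
  have hmono : Mono φ :=
    HomologicalComplex.mono_of_mono_f φ fun i => (ModuleCat.mono_iff_injective _).mpr (hinj i)
  let S : ShortComplex (ChainComplex (ModuleCat R) ℕ) :=
    ShortComplex.mk φ (Limits.cokernel.π φ) (Limits.cokernel.condition φ)
  have hS : S.ShortExact :=
    { exact := ShortComplex.exact_cokernel φ
      mono_f := hmono
      epi_g := inferInstanceAs (Epi (Limits.cokernel.π φ)) }
  have hdeg (i : ℕ) := hS.map_of_exact (HomologicalComplex.eval (ModuleCat R) _ i)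
  have hsurj (i : ℕ) : Function.Surjective (S.g.f i) := (hdeg i).moduleCat_surjective_g
  have hker (i : ℕ) (x : D.X i) (hx : S.g.f i x = 0) : x ∈ LinearMap.range (φ.f i).hom :=
    ((ShortComplex.moduleCat_exact_iff _).mp (hdeg i).exact) x hx
  have hzero (i : ℕ) (x : C.X i) : S.g.f i (φ.f i x) = 0 :=
    ShortComplex.moduleCat_zero_apply (S.map (HomologicalComplex.eval (ModuleCat R) _ i)) x
  have hcomm (i j : ℕ) (x : D.X i) : S.X₃.d i j (S.g.f i x) = S.g.f j (D.d i j x) :=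
    (ConcreteCategory.congr_hom (S.g.comm i j) x)
  have hacyclic (i : ℕ) : S.X₃.ExactAt i := by
    rw [S.X₃.exactAt_iff' (i + 1) i ((ComplexShape.down ℕ).next i) (by simp) rfl,
      ShortComplex.moduleCat_exact_iff]
    intro x hx
    obtain ⟨c, rfl⟩ := hsurj i x
    have hx' : S.X₃.d i ((ComplexShape.down ℕ).next i) (S.g.f i c) = 0 := hx
    obtain ⟨d, b, hb⟩ := hrel i c fun m => by
      by_cases hm : (ComplexShape.down ℕ).Rel i m
      · obtain rfl := (ComplexShape.down ℕ).next_eq' hm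
        refine hker _ _ ?_
        rw [← hcomm, hx']
      · rw [D.shape i m hm]
        exact Submodule.zero_mem _
    refine ⟨S.g.f (i + 1) d, ?_⟩
    change S.X₃.d (i + 1) i (S.g.f (i + 1) d) = S.g.f i c
    rw [hcomm, ← sub_eq_zero, ← map_sub, ← neg_sub, map_neg, ← hb]
    exact neg_eq_zero.mpr (hzero i b)
  have hmonoH : Mono (HomologicalComplex.homologyMap φ n) :=
    (hS.homology_exact₁ (n + 1) n rfl).mono_g
      (((HomologicalComplex.exactAt_iff_isZero_homology _ _).mp (hacyclic (n + 1))).eq_of_src _ _)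
  have hepiH : Epi (HomologicalComplex.homologyMap φ n) :=
    (hS.homology_exact₂ n).epi_f
      (((HomologicalComplex.exactAt_iff_isZero_homology _ _).mp (hacyclic n)).eq_of_tgt _ _)
  exact isIso_of_mono_of_epi _

end Criterion

/-! ### Homology of full subcomplexes -/

section Collapse

variable {V W : Type u} [LinearOrder V] [LinearOrder W] (k : Type v) [Field k]

theorem chainComplex_d (K : PreAbstractSimplicialComplex V) (n : ℕ) :
    (chainComplex k K).d (n + 1) n = ModuleCat.ofHom (boundary k K n) := by
  simp only [chainComplex, ChainComplex.of_d]

/-- The augmented boundary of a `0`-chain is a multiple of the empty set. -/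
theorem setBoundary_toSets_zero_mem_supported {L : PreAbstractSimplicialComplex W}
    (c : Chain k L 0) : setBoundary k (toSets k L 0 c) ∈ Finsupp.supported k k {∅} := by
  refine Finsupp.induction_linear c ?_ ?_ ?_
  · rw [map_zero, map_zero]
    exact Submodule.zero_mem _
  · intro c d hc hd
    rw [map_add, map_add]
    exact Submodule.add_mem _ hc hd
  · intro σ a
    obtain ⟨w, hw⟩ := Finset.card_eq_one.mp σ.card_vertices
    rw [toSets_single, hw, ← mul_one a, ← smul_eq_mul, ← Finsupp.smul_single, map_smul,
      setBoundary_single, Finset.sum_singleton, Finset.erase_singleton]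
    exact Submodule.smul_mem _ _ (Submodule.smul_mem _ _ (Finsupp.single_mem_supported k _ rfl))

/-- The relative acyclicity of a full subcomplex, if the vertices of a simplex outside the
subcomplex determine a vertex of the subcomplex by which all simplices with these outside vertices
can be enlarged. -/
theorem exists_sub_boundary_mem_range (f : V ↪o W)
    {K : PreAbstractSimplicialComplex V} {L : PreAbstractSimplicialComplex W}
    (h : ∀ S ∈ K, S.map f.toEmbedding ∈ L) (h' : ∀ S, S.map f.toEmbedding ∈ L → S ∈ K)
    (hcone : ∀ S ∈ L, (∃ w ∈ S, w ∉ Set.range f) → ∃ x : V, ∀ S' ∈ L,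
      (∀ w, w ∉ Set.range f → (w ∈ S' ↔ w ∈ S)) → insert (f x) S' ∈ L) {n : ℕ} (c : Chain k L n)
    (hc : setBoundary k (toSets k L n c) ∈
      Finsupp.supported k k {S : Finset W | ∀ w ∈ S, w ∈ Set.range f}) :
    ∃ d : Chain k L (n + 1), c - boundary k L n d ∈
      LinearMap.range (Finsupp.lmapDomain k k (Simplex.map f h (n := n))) := by
  classical
  have hempty : {S : Finset W | S.filter (· ∉ Set.range f) = ∅} =
      {S : Finset W | ∀ w ∈ S, w ∈ Set.range f} := by
    ext S
    simp [Finset.filter_eq_empty_iff]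
  rcases isEmpty_or_nonempty W with hW | hW
  · refine ⟨0, (mem_range_chainMapOfEmbedding_iff k f h h' n _).mpr ?_⟩
    exact fun S _ w => isEmptyElim w
  -- the vertex to be inserted, as a function of the set of outside vertices
  obtain ⟨v, hv⟩ : ∃ v : Finset W → W, ∀ S ∈ L, (S.filter (· ∉ Set.range f)).Nonempty →
      v (S.filter (· ∉ Set.range f)) ∈ Set.range f ∧
        insert (v (S.filter (· ∉ Set.range f))) S ∈ L := by
    have : ∀ T : Finset W, ∃ w : W, ∀ S ∈ L, S.filter (· ∉ Set.range f) = T → T.Nonempty →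
        w ∈ Set.range f ∧ insert w S ∈ L := by
      intro T
      by_cases hT : ∃ S ∈ L, S.filter (· ∉ Set.range f) = T ∧ T.Nonempty
      · obtain ⟨S, hS, rfl, w, hw⟩ := hT
        obtain ⟨hwS, hwf⟩ := Finset.mem_filter.mp hw
        obtain ⟨x, hx⟩ := hcone S hS ⟨w, hwS, hwf⟩
        refine ⟨f x, fun S' hS' heq _ => ⟨⟨x, rfl⟩, hx S' hS' fun z hz => ?_⟩⟩
        have := Finset.ext_iff.mp heq z
        rwa [Finset.mem_filter, Finset.mem_filter, and_iff_left hz, and_iff_left hz] at this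
      · exact ⟨hW.some, fun S hS h₁ h₂ => (hT ⟨S, hS, h₁, h₂⟩).elim⟩
    choose v hv using this
    exact ⟨v, fun S hS hne => hv _ S hS rfl hne⟩
  have hcL : toSets k L n c ∈ Finsupp.supported k k {S | S ∈ L ∧ S.card = n + 1} := by
    rw [← range_toSets]
    exact ⟨c, rfl⟩
  rw [← hempty] at hc
  obtain ⟨d, hd, hcd⟩ := exists_sub_setBoundary_mem_supported k (v := v)
    (fun S hS hne => ⟨not_not.mpr (hv S hS hne).1, (hv S hS hne).2⟩) hcL hc
  rw [← range_toSets] at hd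
  obtain ⟨d, rfl⟩ := hd
  refine ⟨d, (mem_range_chainMapOfEmbedding_iff k f h h' n _).mpr ?_⟩
  rwa [hempty, ← toSets_boundary, ← map_sub] at hcd

theorem isIso_homologyMap_chainMapOfEmbedding (f : V ↪o W)
    {K : PreAbstractSimplicialComplex V} {L : PreAbstractSimplicialComplex W}
    (h : ∀ S ∈ K, S.map f.toEmbedding ∈ L) (h' : ∀ S, S.map f.toEmbedding ∈ L → S ∈ K)
    (hcone : ∀ S ∈ L, (∃ w ∈ S, w ∉ Set.range f) → ∃ x : V, ∀ S' ∈ L,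
      (∀ w, w ∉ Set.range f → (w ∈ S' ↔ w ∈ S)) → insert (f x) S' ∈ L) (n : ℕ) :
    IsIso (HomologicalComplex.homologyMap (chainMapOfEmbedding k f h) n) := by
  refine isIso_homologyMap_of_relative_acyclic _ (chainMapOfEmbedding_injective k f h) ?_ n
  intro n c hc
  rw [chainComplex_d]
  refine exists_sub_boundary_mem_range k f h h' hcone (n := n) c ?_
  cases n with
  | zero =>
    refine Finsupp.supported_mono ?_ (setBoundary_toSets_zero_mem_supported k c)
    rintro _ rfl w hw
    exact absurd hw (Finset.notMem_empty w)
  | succ n =>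
    have hcn := hc n
    rw [chainComplex_d] at hcn
    have := (mem_range_chainMapOfEmbedding_iff k f h h' n _).mp hcn
    exact toSets_boundary k L n c ▸ this

end Collapse

/-! ### The functorial Dowker theorem -/

section Persistence

variable {V W : Type u} [LinearOrder V] [LinearOrder W] (k : Type v) [Field k] {P : Type*}
  [Preorder P]

/-- A family of embeddings of complexes along one order embedding of the vertex sets, as a morphism
of persistence modules. -/
noncomputable def persistenceMap (f : V ↪o W) (F : P →o PreAbstractSimplicialComplex V)
    (G : P →o PreAbstractSimplicialComplex W) (h : ∀ p, ∀ S ∈ F p, S.map f.toEmbedding ∈ G p)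
    (n : ℕ) : persistenceModule k F n ⟶ persistenceModule k G n where
  app p := HomologicalComplex.homologyMap (chainMapOfEmbedding k f (h p)) n
  naturality p q g := by
    have hcomm : chainMap k (F.monotone (leOfHom g)) ≫ chainMapOfEmbedding k f (h q) =
        chainMapOfEmbedding k f (h p) ≫ chainMap k (G.monotone (leOfHom g)) := by
      refine HomologicalComplex.hom_ext _ _ fun i => ?_
      exact congrArg ModuleCat.ofHom (((Finsupp.lmapDomain_comp k k
        (Simplex.incl (F.monotone (leOfHom g)) (n := i)) (Simplex.map f (h q) (n := i)))).symm.trans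
        (Finsupp.lmapDomain_comp k k (Simplex.map f (h p) (n := i))
          (Simplex.incl (G.monotone (leOfHom g)) (n := i))))
    have := congrArg (fun φ => HomologicalComplex.homologyMap φ n) hcomm
    simp only [HomologicalComplex.homologyMap_comp] at this
    exact this

theorem nonempty_persistenceModule_iso (f : V ↪o W) (F : P →o PreAbstractSimplicialComplex V)
    (G : P →o PreAbstractSimplicialComplex W) (h : ∀ p S, S ∈ F p ↔ S.map f.toEmbedding ∈ G p)
    (hcone : ∀ p, ∀ S ∈ G p, (∃ w ∈ S, w ∉ Set.range f) → ∃ x : V, ∀ S' ∈ G p,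
      (∀ w, w ∉ Set.range f → (w ∈ S' ↔ w ∈ S)) → insert (f x) S' ∈ G p) (n : ℕ) :
    Nonempty (persistenceModule k F n ≅ persistenceModule k G n) := by
  have happ : ∀ p, IsIso ((persistenceMap k f F G (fun p S => (h p S).mp) n).app p) := fun p =>
    isIso_homologyMap_chainMapOfEmbedding k f (fun S => (h p S).mp) (fun S => (h p S).mpr)
      (hcone p) n
  have := NatIso.isIso_of_isIso_app (persistenceMap k f F G (fun p S => (h p S).mp) n)
  exact ⟨asIso (persistenceMap k f F G (fun p S => (h p S).mp) n)⟩

end Persistence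

section Dowker

variable {X Y : Type u}

/-- The complex that joins the two Dowker complexes of a relation `R` between `X` and `Y`. Its
simplices are the nonempty finite sets `σ ⊔ τ` with `σ ⊆ X` and `τ ⊆ Y` such that `R x y` for all
`x ∈ σ`, `y ∈ τ`, and such that `σ` is a simplex of the one Dowker complex if `τ` is empty, and
`τ` of the other if `σ` is empty. The two existential conditions express the last part; they are
automatic if `σ` and `τ` are both nonempty. -/
def joinComplex (R : X → Y → Prop) : PreAbstractSimplicialComplex (X ⊕ₗ Y) where
  faces := {S | S.Nonempty ∧ (∀ x y, Sum.inlₗ x ∈ S → Sum.inrₗ y ∈ S → R x y) ∧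
    (∃ y, ∀ x, Sum.inlₗ x ∈ S → R x y) ∧ ∃ x, ∀ y, Sum.inrₗ y ∈ S → R x y}
  isRelLowerSet_faces := by
    rintro S ⟨hne, hR, ⟨y, hy⟩, x, hx⟩
    exact ⟨hne, fun T hT hTne => ⟨hTne, fun x y h₁ h₂ => hR x y (hT h₁) (hT h₂),
      ⟨y, fun x h => hy x (hT h)⟩, x, fun y h => hx y (hT h)⟩⟩

/-- The join complexes of a monotone family of relations. -/
def joinFiltration {P : Type*} [Preorder P] (R : P →o (X → Y → Prop)) :
    P →o PreAbstractSimplicialComplex (X ⊕ₗ Y) where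
  toFun p := joinComplex (R p)
  monotone' := by
    rintro p q hpq S ⟨hne, hR, ⟨y, hy⟩, x, hx⟩
    exact ⟨hne, fun x y h₁ h₂ => R.monotone hpq x y (hR x y h₁ h₂),
      ⟨y, fun x h => R.monotone hpq x y (hy x h)⟩, x, fun y h => R.monotone hpq x y (hx y h)⟩

variable [LinearOrder X] [LinearOrder Y] {P : Type*} [Preorder P] (R : P →o (X → Y → Prop))
  (k : Type v) [Field k]

/-- The Dowker complexes on `X` have the homology of the join complexes: a simplex `σ ⊔ τ` with
`τ ≠ ∅` can be enlarged by any `x` that is related to all elements of `τ`. -/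
theorem nonempty_persistenceModule_iso_join_left (F : P →o PreAbstractSimplicialComplex X)
    (hF : ∀ p S, S ∈ F p ↔ S.Nonempty ∧ ∃ y, ∀ x ∈ S, R p x y) (n : ℕ) :
    Nonempty (persistenceModule k F n ≅ persistenceModule k (joinFiltration R) n) := by
  refine nonempty_persistenceModule_iso k
    (OrderEmbedding.ofStrictMono (toLex ∘ Sum.inl : X → X ⊕ₗ Y) Sum.Lex.inl_strictMono) F _ ?_ ?_ n
  · intro p S
    rw [hF]
    constructor
    · rintro ⟨⟨x, hx⟩, y, hy⟩
      refine ⟨⟨_, Finset.mem_map_of_mem _ hx⟩, ?_, ⟨y, ?_⟩, x, ?_⟩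
      · intro x' y' _ h
        simp at h
      · intro x' h
        simp at h
        exact hy x' h
      · intro y' h
        simp at h
    · rintro ⟨hne, -, ⟨y, hy⟩, -⟩
      exact ⟨by simpa using hne, y, fun x hx => hy x (Finset.mem_map_of_mem _ hx)⟩
  · rintro p S ⟨-, -, -, x, hx⟩ ⟨w, hw, hwf⟩
    have hinr : ∀ y : Y, (Sum.inrₗ y : X ⊕ₗ Y) ∉ Set.range
        (OrderEmbedding.ofStrictMono (toLex ∘ Sum.inl : X → X ⊕ₗ Y) Sum.Lex.inl_strictMono) := by
      rintro y ⟨x, hx⟩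
      simp at hx
    obtain ⟨y, rfl⟩ : ∃ y, Sum.inrₗ y = w := by
      rcases h : ofLex w with x | y
      · exact (hwf ⟨x, congrArg toLex h.symm⟩).elim
      · exact ⟨y, congrArg toLex h.symm⟩
    refine ⟨x, fun S' ⟨_, hR', _, x', hx'⟩ heq => ?_⟩
    have hx₁ : ∀ x₁, Sum.inlₗ x₁ ∈ insert (Sum.inlₗ x : X ⊕ₗ Y) S' → x₁ = x ∨ Sum.inlₗ x₁ ∈ S' := by
      intro x₁ h₁
      simpa using h₁
    have hy₁ : ∀ y₁, Sum.inrₗ y₁ ∈ insert (Sum.inlₗ x : X ⊕ₗ Y) S' → Sum.inrₗ y₁ ∈ S' := by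
      intro y₁ h₁
      simpa using h₁
    have hyS : Sum.inrₗ y ∈ S' := (heq _ (hinr y)).mpr hw
    refine ⟨Finset.insert_nonempty _ _, ?_, ⟨y, ?_⟩, x', fun y₁ h₁ => hx' y₁ (hy₁ y₁ h₁)⟩
    · intro x₁ y₁ h₁ h₂
      rcases hx₁ x₁ h₁ with rfl | h₁
      · exact hx y₁ ((heq _ (hinr y₁)).mp (hy₁ y₁ h₂))
      · exact hR' x₁ y₁ h₁ (hy₁ y₁ h₂)
    · intro x₁ h₁
      rcases hx₁ x₁ h₁ with rfl | h₁
      · exact hx y hw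
      · exact hR' x₁ y h₁ hyS

/-- The Dowker complexes on `Y` have the homology of the join complexes. -/
theorem nonempty_persistenceModule_iso_join_right (G : P →o PreAbstractSimplicialComplex Y)
    (hG : ∀ p S, S ∈ G p ↔ S.Nonempty ∧ ∃ x, ∀ y ∈ S, R p x y) (n : ℕ) :
    Nonempty (persistenceModule k G n ≅ persistenceModule k (joinFiltration R) n) := by
  refine nonempty_persistenceModule_iso k
    (OrderEmbedding.ofStrictMono (toLex ∘ Sum.inr : Y → X ⊕ₗ Y) Sum.Lex.inr_strictMono) G _ ?_ ?_ n
  · intro p S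
    rw [hG]
    constructor
    · rintro ⟨⟨y, hy⟩, x, hx⟩
      refine ⟨⟨_, Finset.mem_map_of_mem _ hy⟩, ?_, ⟨y, ?_⟩, x, ?_⟩
      · intro x' y' h _
        simp at h
      · intro x' h
        simp at h
      · intro y' h
        simp at h
        exact hx y' h
    · rintro ⟨hne, -, -, x, hx⟩
      exact ⟨by simpa using hne, x, fun y hy => hx y (Finset.mem_map_of_mem _ hy)⟩
  · rintro p S ⟨-, -, ⟨y, hy⟩, -⟩ ⟨w, hw, hwf⟩
    have hinl : ∀ x : X, (Sum.inlₗ x : X ⊕ₗ Y) ∉ Set.range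
        (OrderEmbedding.ofStrictMono (toLex ∘ Sum.inr : Y → X ⊕ₗ Y) Sum.Lex.inr_strictMono) := by
      rintro x ⟨y, hy⟩
      simp at hy
    obtain ⟨x, rfl⟩ : ∃ x, Sum.inlₗ x = w := by
      rcases h : ofLex w with x | y
      · exact ⟨x, congrArg toLex h.symm⟩
      · exact (hwf ⟨y, congrArg toLex h.symm⟩).elim
    refine ⟨y, fun S' ⟨_, hR', ⟨y', hy'⟩, _⟩ heq => ?_⟩
    have hy₁ : ∀ y₁, Sum.inrₗ y₁ ∈ insert (Sum.inrₗ y : X ⊕ₗ Y) S' → y₁ = y ∨ Sum.inrₗ y₁ ∈ S' := by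
      intro y₁ h₁
      simpa using h₁
    have hx₁ : ∀ x₁, Sum.inlₗ x₁ ∈ insert (Sum.inrₗ y : X ⊕ₗ Y) S' → Sum.inlₗ x₁ ∈ S' := by
      intro x₁ h₁
      simpa using h₁
    have hxS : Sum.inlₗ x ∈ S' := (heq _ (hinl x)).mpr hw
    refine ⟨Finset.insert_nonempty _ _, ?_, ⟨y', fun x₁ h₁ => hy' x₁ (hx₁ x₁ h₁)⟩, x, ?_⟩
    · intro x₁ y₁ h₁ h₂
      rcases hy₁ y₁ h₂ with rfl | h₂
      · exact hy x₁ ((heq _ (hinl x₁)).mp (hx₁ x₁ h₁))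
      · exact hR' x₁ y₁ (hx₁ x₁ h₁) h₂
    · intro y₁ h₁
      rcases hy₁ y₁ h₁ with rfl | h₁
      · exact hy x hw
      · exact hR' x y₁ hxS h₁

/-- **Functorial Dowker theorem**: for a monotone family of relations between `X` and `Y`, the
Dowker complexes on `X` and those on `Y` have isomorphic persistence modules. -/
theorem nonempty_persistenceModule_iso_of_dowker (F : P →o PreAbstractSimplicialComplex X)
    (G : P →o PreAbstractSimplicialComplex Y)
    (hF : ∀ p S, S ∈ F p ↔ S.Nonempty ∧ ∃ y, ∀ x ∈ S, R p x y)
    (hG : ∀ p S, S ∈ G p ↔ S.Nonempty ∧ ∃ x, ∀ y ∈ S, R p x y) (n : ℕ) :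
    Nonempty (persistenceModule k F n ≅ persistenceModule k G n) := by
  obtain ⟨e⟩ := nonempty_persistenceModule_iso_join_left R k F hF n
  obtain ⟨e'⟩ := nonempty_persistenceModule_iso_join_right R k G hG n
  exact ⟨e ≪≫ e'.symm⟩

end Dowker

end SimplicialHomology

/-! ### The relation between points and clusters -/

namespace PartitionSequence

universe u

variable {X : Type u} [Fintype X] [DecidableEq X] {M : ℕ} [NeZero M] (Θ : PartitionSequence X M)

/-- Membership of a point in a cluster of one of the partitions that occur in `[s, t]`. -/
def clusterRelation : Θ.Index →o (X → Θ.ClusterIndex → Prop) where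
  toFun p x c := (Θ.layer p.fst ≤ c.level ∧ c.level ≤ Θ.layer p.snd) ∧ x ∈ c.cluster
  monotone' := by
    rintro p q ⟨h₁, h₂⟩ x c ⟨⟨hl, hr⟩, hx⟩
    exact ⟨⟨(Θ.layer_mono h₁).trans hl, hr.trans (Θ.layer_mono h₂)⟩, hx⟩

theorem θ_eq_partitionAt_layer (r : Θ.Scale) : Θ.θ r = Θ.partitionAt (Θ.layer r) :=
  Θ.eq_of_mem _ r (Θ.t_layer_le r) fun m hm => by
    by_contra h
    exact absurd (Θ.le_layer (not_lt.mp h)) (not_le.mpr hm)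

theorem mem_mcbif_iff (p : Θ.Index) (σ : Finset X) :
    σ ∈ Θ.mcbif p ↔ σ.Nonempty ∧ ∃ c, ∀ x ∈ σ, Θ.clusterRelation p x c := by
  constructor
  · rintro ⟨hne, r, hr₁, hr₂, C, hC, hσC⟩
    rw [θ_eq_partitionAt_layer] at hC
    exact ⟨hne, ⟨Θ.layer r, C, hC⟩,
      fun x hx => ⟨⟨Θ.layer_mono hr₁, Θ.layer_mono hr₂⟩, hσC hx⟩⟩
  · rintro ⟨⟨x₀, hx₀⟩, c, hc⟩
    obtain ⟨⟨hl, hr⟩, -⟩ := hc x₀ hx₀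
    refine ⟨⟨x₀, hx₀⟩, ?_⟩
    rcases hl.eq_or_lt with heq | hlt
    · -- the partition at the level of `c` is the one at the scale `s`, where `s` may exceed `t_ℓ`
      refine ⟨p.fst, le_rfl, p.fst_le_snd, c.cluster, ?_, fun x hx => (hc x hx).2⟩
      rw [θ_eq_partitionAt_layer, heq]
      exact c.mem_parts
    · refine ⟨⟨Θ.t c.level, Θ.strictMono_t.monotone (Fin.zero_le _)⟩, ?_, ?_, c.cluster,
        c.mem_parts, fun x hx => (hc x hx).2⟩
      · by_contra h
        exact absurd (Θ.le_layer (not_le.mp h).le) (not_le.mpr hlt)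
      · exact (Θ.strictMono_t.monotone hr).trans (Θ.t_layer_le p.snd)

theorem mem_nerveMcbif_iff (p : Θ.Index) (σ : Finset Θ.ClusterIndex) :
    σ ∈ Θ.nerveMcbif p ↔ σ.Nonempty ∧ ∃ x, ∀ c ∈ σ, Θ.clusterRelation p x c := by
  constructor
  · rintro ⟨hne, hl, x, hx⟩
    exact ⟨hne, x, fun c hc => ⟨hl c hc, hx c hc⟩⟩
  · rintro ⟨hne, x, hx⟩
    exact ⟨hne, fun c hc => (hx c hc).1, x, fun c hc => (hx c hc).2⟩

end PartitionSequence

theorem propositionA1 {X : Type*} [Fintype X] [LinearOrder X] {M : ℕ} [NeZero M]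
    (Θ : PartitionSequence X M) [LinearOrder Θ.ClusterIndex] (k : Type*) [Field k] (n : ℕ) :
    Nonempty (SimplicialHomology.persistenceModule k Θ.mcbif n ≅
      SimplicialHomology.persistenceModule k Θ.nerveMcbif n) :=
  SimplicialHomology.nonempty_persistenceModule_iso_of_dowker Θ.clusterRelation k Θ.mcbif
    Θ.nerveMcbif Θ.mem_mcbif_iff Θ.mem_nerveMcbif_iff n
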